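/- Throughout, $\|\cdot\|_2$ is the matrix 2-norm and $\|\cdot\|_F$ the Frobenius norm on $\mathbb C^{n\times n}$. For $r>0$ and $M\in\mathbb C^{n\times n}$ let $$\Lambda_r(M)=\{\lambda\in\mathbb C:\ \lambda \text{ is an eigenvalue of } M+\Theta \text{ for some } \Theta\in\mathbb C^{n\times n} \text{ with } \|\Theta\|_F\le r\}$$ be the $r$-pseudospectrum of $M$. Let $\mathcal S\subset\mathbb C^{n\times n}$ be a real-linear (for example, complex-linear) subspace, let $A\in\mathbb C^{n\times n}$ have all its eigenvalues in the open left half-plane, and let $\varepsilon_\star$ be the stability radius of $A$, that is, the largest $r>0$ such that $\Lambda_r(A)$ has no points of positive real part. Let $0<\varepsilon<\varepsilon_\star$, and let $\delta=\delta_\varepsilon^{\mathcal S}(A)$ be the $\mathcal S$-structured $\varepsilon$-stability radius of $A$, that is, the largest $\delta>0$ such that for every $\Delta\in\mathcal S$ with $\|\Delta\|_F\le\delta$ the set $\Lambda_\varepsilon(A+\Delta)$ has no points of positive real part (it is assumed that such a largest $\delta$ exists, i.e. that $\delta_\varepsilon^{\mathcal S}(A)$ is finite). By a contour we mean a finite union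 of oriented closed piecewise $C^1$ curves in $\mathbb C$. Let $C$ be a contour that surrounds $\Lambda_{\varepsilon+\delta}(A)$: $C$ lies in the closure of $\mathbb C\setminus\Lambda_{\varepsilon+\delta}(A)$ (so it may touch or run along the boundary of the pseudospectrum), and its total winding number around every point of $\Lambda_{\varepsilon+\delta}(A)$ that is not on $C$ equals $1$. Suppose that $C$ can be subdivided into finitely many $C^1$ arcs each of which lies in the closed left or in the closed right half-plane. Let $\Gamma$ be a closed contour in the closed left half-plane that consists of (i) the part of $C$ in the left half-plane, i.e. the arcs of such a subdivision chosen as left arcs (the others lying in the closed right half-plane), and (ii) finitely many oriented intervals of the imaginary axis that close the contour. Let $|\Gamma|$ be the length of $\Gamma$. **Proposition.** For every $\Delta\in\mathcal S$ with $\|\Delta\|_F\le\delta_\varepsilon^{\mathcal S}(A)$, $$\bigl\| e^{t(A+\Delta)}\bigr\|_2\ \le\ \frac{|\Gamma|}{2\pi\varepsilon}\qquad\text{for all } t>0 .$$ -/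

import Mathlib

open Set

noncomputable section

namespace TransientBound

/-- The Frobenius norm of a complex square matrix. -/
def frobNorm {n : ℕ} (M : Matrix (Fin n) (Fin n) ℂ) : ℝ :=
  Real.sqrt (∑ i, ∑ j, ‖M i j‖ ^ 2)

/-- The matrix 2-norm: the operator norm with respect to the Euclidean norm on `ℂⁿ`. -/
def norm2 {n : ℕ} (M : Matrix (Fin n) (Fin n) ℂ) : ℝ :=
  ‖Matrix.toEuclideanCLM (𝕜 := ℂ) M‖

/-- `z` is an eigenvalue of `M`. -/
def IsEigenvalue {n : ℕ} (M : Matrix (Fin n) (Fin n) ℂ) (z : ℂ) : Prop :=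
  Module.End.HasEigenvalue (Matrix.toLin' M) z

/-- The unstructured `ε`-pseudospectrum of `A`: all eigenvalues of `A + Θ` with `‖Θ‖_F ≤ ε`. -/
def pseudospectrum {n : ℕ} (ε : ℝ) (A : Matrix (Fin n) (Fin n) ℂ) : Set ℂ :=
  {z | ∃ Θ : Matrix (Fin n) (Fin n) ℂ, frobNorm Θ ≤ ε ∧ IsEigenvalue (A + Θ) z}

/-- `r` is the (unstructured) stability radius of `A`: the largest `r > 0` such that the
`r`-pseudospectrum of `A` has no points of positive real part. -/
def IsStabilityRadius {n : ℕ} (A : Matrix (Fin n) (Fin n) ℂ) (r : ℝ) : Prop :=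
  IsGreatest {r : ℝ | 0 < r ∧ ∀ z ∈ pseudospectrum r A, z.re ≤ 0} r

/-- `δ` is the `S`-structured `ε`-stability radius of `A`: the largest `δ > 0` such that for every
`Δ ∈ S` with `‖Δ‖_F ≤ δ` the unstructured `ε`-pseudospectrum of `A + Δ` has no points of positive
real part.  A real-linear structure space `S` is allowed (complex subspaces are a special case). -/
def IsStructuredStabilityRadius {n : ℕ} (S : Submodule ℝ (Matrix (Fin n) (Fin n) ℂ)) (ε : ℝ)
    (A : Matrix (Fin n) (Fin n) ℂ) (δ : ℝ) : Prop :=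
  IsGreatest {δ : ℝ | 0 < δ ∧ ∀ Δ ∈ S, frobNorm Δ ≤ δ →
    ∀ z ∈ pseudospectrum ε (A + Δ), z.re ≤ 0} δ

/-- An oriented `C¹` arc in the complex plane, parametrized over `[0, 1]`
(only the values on `[0, 1]` matter). -/
structure Arc where
  /-- the parametrization -/
  toFun : ℝ → ℂ
  contDiffOn : ContDiffOn ℝ 1 toFun (Icc 0 1)

namespace Arc

/-- The initial point of an arc. -/
def source (γ : Arc) : ℂ := γ.toFun 0

/-- The end point of an arc. -/
def target (γ : Arc) : ℂ := γ.toFun 1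

/-- The set of points of an arc. -/
def trace (γ : Arc) : Set ℂ := γ.toFun '' Icc 0 1

/-- The length of an arc. -/
def length (γ : Arc) : ℝ := ∫ t in (0 : ℝ)..1, ‖deriv γ.toFun t‖

/-- The complex line integral of `f` along an arc. -/
def integral (γ : Arc) (f : ℂ → ℂ) : ℂ :=
  ∫ t in (0 : ℝ)..1, f (γ.toFun t) * deriv γ.toFun t

/-- The oriented interval on the imaginary axis from `i a` to `i b`. -/
def imagInterval (a b : ℝ) : Arc where
  toFun t := ((a + t * (b - a) : ℝ) : ℂ) * Complex.I
  contDiffOn := by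
    have h : ContDiff ℝ 1 fun t : ℝ => a + t * (b - a) := by fun_prop
    exact ((Complex.ofRealCLM.contDiff.comp h).mul contDiff_const).contDiffOn

end Arc

/-- A finite family of arcs is closed if every point is the initial point of as many arcs as it is
the end point of.  Equivalently, the arcs can be concatenated to finitely many closed piecewise
`C¹` curves; so a closed family is a piecewise `C¹` contour, or a union of several ones, presented
by a subdivision into `C¹` arcs. -/
def IsClosedContour (C : List Arc) : Prop :=
  (C.map Arc.source).Perm (C.map Arc.target)

/-- The set of points of a finite family of arcs. -/
def contourTrace (C : List Arc) : Set ℂ := {z | ∃ γ ∈ C, z ∈ γ.trace}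

/-- The length of a finite family of arcs. -/
def contourLength (C : List Arc) : ℝ := (C.map Arc.length).sum

/-- The (total) winding number of a contour around a point off the contour. -/
def windingNumber (C : List Arc) (z : ℂ) : ℂ :=
  (2 * Real.pi * Complex.I)⁻¹ * (C.map fun γ => γ.integral fun w => (w - z)⁻¹).sum

/-- The contour (or union of contours) `C` surrounds `K`: it runs in the complement of `K`, where it
may touch the boundary of `K`, and it winds once around each point of `K` not on `C`. -/
def Surrounds (C : List Arc) (K : Set ℂ) : Prop :=
  IsClosedContour C ∧ contourTrace C ⊆ closure Kᶜ ∧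
    ∀ z ∈ K, z ∉ contourTrace C → windingNumber C z = 1

/-- `Γ` is a closed contour consisting of (i) the part of the contour `C` in the left half-plane and
(ii) finitely many intervals on the imaginary axis.  Here `C` has been subdivided into arcs `L` in
the closed left and arcs `R` in the closed right half-plane. -/
def IsLeftClosing (C Γ : List Arc) : Prop :=
  ∃ (L R : List Arc) (J : List (ℝ × ℝ)),
    C.Perm (L ++ R) ∧
    (∀ z ∈ contourTrace L, z.re ≤ 0) ∧
    (∀ z ∈ contourTrace R, 0 ≤ z.re) ∧
    Γ.Perm (L ++ J.map fun p => Arc.imagInterval p.1 p.2) ∧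
    IsClosedContour Γ

end TransientBound

end

open TransientBound

/-! Write `b` for `A + Δ` and `R(z)` for its resolvent. The Dunford formula gives `2πi e^{tb} = ∫_Γ
e^{tz} R(z) dz`. On `Γ` one has `|e^{tz}| ≤ 1`, as `Re z ≤ 0`, and `‖R(z)‖ ≤ 1/ε`, so the length of
`Γ` yields the bound. The resolvent bound says that the smallest singular value of `z - b` is at
least `ε`. On the imaginary axis this is the definition of `δ` plus a limit
(`mul_norm_le_of_mem_closure`). On `C` the smallest singular value of `z - A` is at least `ε + δ`,
and `Δ` lowers it by at most `δ`. The Dunford formula (`contourIntegral_exp_mul_resolvent`) is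
obtained from primitives alone, without a general Cauchy theorem: partial fractions and
Cayley–Hamilton show `∫ R = 2πi`, and Duhamel's formula inserts the exponential. Its input is that
`Γ` winds once around each eigenvalue of `b`; this passes from `C` to `Γ` by
`IsLeftClosing.contourIntegral_inv_sub_eq`. -/

noncomputable section

namespace TransientBound


/-! ### Line integrals along a single arc. -/

namespace Arc

variable (γ : Arc)

theorem continuousOn : ContinuousOn γ.toFun (Icc 0 1) := γ.contDiffOn.continuousOn

/-- At the endpoints `deriv` depends on values outside `[0, 1]`. The one-sided derivative is
continuous up to the endpoints and gives the same integrals, so the estimates use it instead. -/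
theorem continuousOn_derivWithin : ContinuousOn (derivWithin γ.toFun (Icc 0 1)) (Icc 0 1) :=
  γ.contDiffOn.continuousOn_derivWithin (uniqueDiffOn_Icc zero_lt_one) le_rfl

theorem mem_trace {t : ℝ} (ht : t ∈ Icc (0 : ℝ) 1) : γ.toFun t ∈ γ.trace := ⟨t, ht, rfl⟩

theorem derivWithin_eq {t : ℝ} (ht : t ∈ Ioo (0 : ℝ) 1) :
    derivWithin γ.toFun (Icc 0 1) t = deriv γ.toFun t :=
  derivWithin_of_mem_nhds (Icc_mem_nhds ht.1 ht.2)

theorem hasDerivAt {t : ℝ} (ht : t ∈ Ioo (0 : ℝ) 1) :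
    HasDerivAt γ.toFun (derivWithin γ.toFun (Icc 0 1) t) t :=
  ((γ.contDiffOn.differentiableOn one_ne_zero) t
    (Ioo_subset_Icc_self ht)).hasDerivWithinAt.hasDerivAt (Icc_mem_nhds ht.1 ht.2)

theorem length_eq : γ.length = ∫ t in (0 : ℝ)..1, ‖derivWithin γ.toFun (Icc 0 1) t‖ :=
  intervalIntegral.integral_congr_Ioo_of_le zero_le_one fun t ht => by
    simp only [γ.derivWithin_eq ht]

theorem integral_eq (f : ℂ → ℂ) :
    γ.integral f = ∫ t in (0 : ℝ)..1, f (γ.toFun t) * derivWithin γ.toFun (Icc 0 1) t :=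
  intervalIntegral.integral_congr_Ioo_of_le zero_le_one fun t ht => by
    simp only [γ.derivWithin_eq ht]

theorem continuousOn_integrand {f : ℂ → ℂ} (hf : ContinuousOn f γ.trace) :
    ContinuousOn (fun t => f (γ.toFun t) * derivWithin γ.toFun (Icc 0 1) t) (Icc 0 1) :=
  (hf.comp γ.continuousOn fun _ => γ.mem_trace).mul γ.continuousOn_derivWithin

theorem intervalIntegrable_integrand {f : ℂ → ℂ} (hf : ContinuousOn f γ.trace) :
    IntervalIntegrable (fun t => f (γ.toFun t) * derivWithin γ.toFun (Icc 0 1) t)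
      MeasureTheory.volume 0 1 :=
  (γ.continuousOn_integrand hf).intervalIntegrable_of_Icc zero_le_one

theorem integral_congr {f g : ℂ → ℂ} (h : EqOn f g γ.trace) : γ.integral f = γ.integral g :=
  intervalIntegral.integral_congr_Ioo_of_le zero_le_one fun t ht => by
    simp only [h (γ.mem_trace (Ioo_subset_Icc_self ht))]

theorem integral_add {f g : ℂ → ℂ} (hf : ContinuousOn f γ.trace) (hg : ContinuousOn g γ.trace) :
    γ.integral (fun z => f z + g z) = γ.integral f + γ.integral g := by
  simp only [integral_eq, add_mul]
  exact intervalIntegral.integral_add (γ.intervalIntegrable_integrand hf)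
    (γ.intervalIntegrable_integrand hg)

theorem integral_const_mul (c : ℂ) (f : ℂ → ℂ) :
    γ.integral (fun z => c * f z) = c * γ.integral f := by
  simp only [integral, mul_assoc]
  exact intervalIntegral.integral_const_mul _ _

theorem integral_eq_sub {f F : ℂ → ℂ} (hf : ContinuousOn f γ.trace)
    (hF : ∀ z ∈ γ.trace, HasDerivAt F (f z) z) :
    γ.integral f = F γ.target - F γ.source := by
  rw [integral_eq]
  refine intervalIntegral.integral_eq_sub_of_hasDerivAt_of_le (f := fun t => F (γ.toFun t))
    zero_le_one ?_ ?_ (γ.intervalIntegrable_integrand hf)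
  · exact ContinuousOn.comp (t := γ.trace)
      (fun z hz => (hF z hz).continuousAt.continuousWithinAt) γ.continuousOn
      fun _ => γ.mem_trace
  · exact fun t ht => (hF _ (γ.mem_trace (Ioo_subset_Icc_self ht))).comp t (γ.hasDerivAt ht)

theorem norm_integral_le {f : ℂ → ℂ} {K : ℝ} (hf : ContinuousOn f γ.trace)
    (hK : ∀ z ∈ γ.trace, ‖f z‖ ≤ K) : ‖γ.integral f‖ ≤ K * γ.length := by
  rw [integral_eq, length_eq, ← intervalIntegral.integral_const_mul]
  refine (intervalIntegral.norm_integral_le_integral_norm zero_le_one).trans ?_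
  refine intervalIntegral.integral_mono_on zero_le_one
    (γ.intervalIntegrable_integrand hf).norm
    ((continuousOn_const.mul γ.continuousOn_derivWithin.norm).intervalIntegrable_of_Icc
      zero_le_one) fun t ht => ?_
  rw [norm_mul]
  exact mul_le_mul_of_nonneg_right (hK _ (γ.mem_trace ht)) (norm_nonneg _)

theorem integrableOn_integrand_prod {g : ℂ → ℝ → ℂ} (hg : Continuous (Function.uncurry g))
    (a b : ℝ) :
    MeasureTheory.IntegrableOn (Function.uncurry fun (t s : ℝ) =>
      g (γ.toFun t) s * derivWithin γ.toFun (Icc 0 1) t) (uIoc 0 1 ×ˢ uIoc a b) := by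
  refine MeasureTheory.IntegrableOn.mono_set (t := Icc 0 1 ×ˢ uIcc a b) ?_
    (prod_mono (by rw [uIoc_of_le zero_le_one]; exact Ioc_subset_Icc_self) uIoc_subset_uIcc)
  refine ContinuousOn.integrableOn_compact (isCompact_Icc.prod isCompact_uIcc) ?_
  refine ContinuousOn.mul ?_ ?_
  · exact hg.comp_continuousOn
      ((γ.continuousOn.comp continuousOn_fst fun x hx => hx.1).prodMk continuousOn_snd)
  · exact γ.continuousOn_derivWithin.comp continuousOn_fst fun x hx => hx.1

theorem integral_intervalIntegral_swap {g : ℂ → ℝ → ℂ} (hg : Continuous (Function.uncurry g))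
    (a b : ℝ) :
    γ.integral (fun z => ∫ s in a..b, g z s) = ∫ s in a..b, γ.integral fun z => g z s := by
  simp only [integral_eq, ← intervalIntegral.integral_mul_const]
  exact MeasureTheory.intervalIntegral_intervalIntegral_swap
    (γ.integrableOn_integrand_prod hg a b)

theorem intervalIntegrable_integral {g : ℂ → ℝ → ℂ} (hg : Continuous (Function.uncurry g))
    (a b : ℝ) :
    IntervalIntegrable (fun s => γ.integral fun z => g z s) MeasureTheory.volume a b := by
  have h := γ.integrableOn_integrand_prod hg a b
  rw [MeasureTheory.IntegrableOn, MeasureTheory.Measure.volume_eq_prod,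
    ← MeasureTheory.Measure.prod_restrict] at h
  rw [intervalIntegrable_iff]
  simp only [integral_eq, intervalIntegral.integral_of_le zero_le_one]
  rw [uIoc_of_le zero_le_one] at h
  exact h.integral_prod_right

theorem trace_imagInterval_re {a b : ℝ} {z : ℂ} (hz : z ∈ (imagInterval a b).trace) :
    z.re = 0 := by
  obtain ⟨t, -, rfl⟩ := hz
  simp [imagInterval]

end Arc

/-! ### Integrals along families of arcs. -/

/-- The integral of `f` along a finite family of arcs. -/
def contourIntegral (C : List Arc) (f : ℂ → ℂ) : ℂ := (C.map fun γ => γ.integral f).sum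

theorem contourIntegral_perm {C D : List Arc} (h : C.Perm D) (f : ℂ → ℂ) :
    contourIntegral C f = contourIntegral D f := (h.map _).sum_eq

theorem contourIntegral_append (C D : List Arc) (f : ℂ → ℂ) :
    contourIntegral (C ++ D) f = contourIntegral C f + contourIntegral D f := by
  simp [contourIntegral]

theorem trace_subset_contourTrace {C : List Arc} {γ : Arc} (h : γ ∈ C) :
    γ.trace ⊆ contourTrace C := fun _ hz => ⟨γ, h, hz⟩

theorem contourTrace_cons (γ : Arc) (C : List Arc) :
    contourTrace (γ :: C) = γ.trace ∪ contourTrace C := by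
  ext z; simp [contourTrace]

theorem contourTrace_append (C D : List Arc) :
    contourTrace (C ++ D) = contourTrace C ∪ contourTrace D := by
  ext z; simp [contourTrace, or_and_right, exists_or]

theorem contourTrace_perm {C D : List Arc} (h : C.Perm D) : contourTrace C = contourTrace D := by
  ext z; simp [contourTrace, h.mem_iff]

theorem contourIntegral_congr {C : List Arc} {f g : ℂ → ℂ} (h : EqOn f g (contourTrace C)) :
    contourIntegral C f = contourIntegral C g := by
  unfold contourIntegral
  congr 1
  exact List.map_congr_left fun γ hγ => γ.integral_congr (h.mono (trace_subset_contourTrace hγ))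

theorem contourIntegral_add {C : List Arc} {f g : ℂ → ℂ} (hf : ContinuousOn f (contourTrace C))
    (hg : ContinuousOn g (contourTrace C)) :
    contourIntegral C (fun z => f z + g z) = contourIntegral C f + contourIntegral C g := by
  unfold contourIntegral
  rw [← List.sum_map_add]
  congr 1
  exact List.map_congr_left fun γ hγ => γ.integral_add
    (hf.mono (trace_subset_contourTrace hγ)) (hg.mono (trace_subset_contourTrace hγ))

theorem contourIntegral_const_mul (C : List Arc) (c : ℂ) (f : ℂ → ℂ) :
    contourIntegral C (fun z => c * f z) = c * contourIntegral C f := by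
  simp only [contourIntegral, Arc.integral_const_mul]
  exact List.sum_map_mul_left ..

theorem contourIntegral_eq_sum_sub {C : List Arc} {f F : ℂ → ℂ}
    (hf : ContinuousOn f (contourTrace C))
    (hF : ∀ z ∈ contourTrace C, HasDerivAt F (f z) z) :
    contourIntegral C f = (C.map fun γ => F γ.target - F γ.source).sum := by
  unfold contourIntegral
  congr 1
  exact List.map_congr_left fun γ hγ => γ.integral_eq_sub
    (hf.mono (trace_subset_contourTrace hγ)) fun z hz => hF z (trace_subset_contourTrace hγ hz)

/-- Only endpoint values of `F` enter, so no regularity is needed; this matters later for a branch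
of the logarithm that may jump along some arcs. -/
theorem IsClosedContour.sum_sub_eq_zero {C : List Arc} (hC : IsClosedContour C) (F : ℂ → ℂ) :
    (C.map fun γ => F γ.target - F γ.source).sum = 0 := by
  have h := (List.Perm.map F hC).sum_eq
  rw [List.map_map, List.map_map] at h
  have hsub : ∀ D : List Arc, (D.map fun γ => F γ.target - F γ.source).sum =
      (D.map (F ∘ Arc.target)).sum - (D.map (F ∘ Arc.source)).sum := by
    intro D
    induction D with
    | nil => simp
    | cons γ D ih => simp only [List.map_cons, List.sum_cons, ih, Function.comp]; ring
  rw [hsub, h, sub_self]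

theorem IsClosedContour.contourIntegral_eq_zero {C : List Arc} (hC : IsClosedContour C)
    {f F : ℂ → ℂ} (hf : ContinuousOn f (contourTrace C))
    (hF : ∀ z ∈ contourTrace C, HasDerivAt F (f z) z) : contourIntegral C f = 0 := by
  rw [contourIntegral_eq_sum_sub hf hF, hC.sum_sub_eq_zero]

theorem norm_contourIntegral_le {C : List Arc} {f : ℂ → ℂ} {K : ℝ}
    (hf : ContinuousOn f (contourTrace C)) (hK : ∀ z ∈ contourTrace C, ‖f z‖ ≤ K) :
    ‖contourIntegral C f‖ ≤ K * contourLength C := by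
  induction C with
  | nil => simp [contourIntegral, contourLength]
  | cons γ C ih =>
    rw [contourTrace_cons] at hf hK
    have h1 := γ.norm_integral_le (hf.mono subset_union_left) fun z hz => hK z (Or.inl hz)
    have h2 := ih (hf.mono subset_union_right) fun z hz => hK z (Or.inr hz)
    simp only [contourIntegral, contourLength, List.map_cons, List.sum_cons, mul_add] at h2 ⊢
    exact (norm_add_le _ _).trans (add_le_add h1 h2)

theorem contourIntegral_intervalIntegral_swap (C : List Arc) {g : ℂ → ℝ → ℂ}
    (hg : Continuous (Function.uncurry g)) (a b : ℝ) :
    contourIntegral C (fun z => ∫ s in a..b, g z s) =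
      ∫ s in a..b, contourIntegral C fun z => g z s := by
  -- Integrability is carried through the induction because splitting the integral of the sum
  -- requires it for the tail.
  have key : (contourIntegral C fun z => ∫ s in a..b, g z s) =
      (∫ s in a..b, contourIntegral C fun z => g z s) ∧
      IntervalIntegrable (fun s => contourIntegral C fun z => g z s)
        MeasureTheory.volume a b := by
    induction C with
    | nil => simp [contourIntegral]
    | cons γ C ih =>
      simp only [contourIntegral, List.map_cons, List.sum_cons] at ih ⊢
      exact ⟨by rw [ih.1, γ.integral_intervalIntegral_swap hg,
        intervalIntegral.integral_add (γ.intervalIntegrable_integral hg a b) ih.2],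
        (γ.intervalIntegrable_integral hg a b).add ih.2⟩
  exact key.1


/-! ### Partial fractions along a closed contour. -/

theorem continuous_prod_sub (d : List ℂ) : Continuous fun z => (d.map fun μ => z - μ).prod := by
  induction d with
  | nil => simpa using continuous_const
  | cons μ d ih => simp only [List.map_cons, List.prod_cons]; fun_prop

theorem prod_sub_ne_zero {d : List ℂ} {z : ℂ} (h : z ∉ d) : (d.map fun μ => z - μ).prod ≠ 0 := by
  refine List.prod_ne_zero fun h0 => ?_
  obtain ⟨μ, hμ, h1⟩ := List.mem_map.1 h0
  exact h (sub_eq_zero.1 h1 ▸ hμ)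

theorem continuousOn_inv_prod_sub {d : List ℂ} {s : Set ℂ} (h : ∀ μ ∈ d, μ ∉ s) :
    ContinuousOn (fun z => (d.map fun μ => z - μ).prod⁻¹) s :=
  (continuous_prod_sub d).continuousOn.inv₀ fun z hz => prod_sub_ne_zero fun hd => h z hd hz

/-- Along a closed contour winding once around all points of the list `d`, the reciprocal of
`∏ (z - μ)` integrates to `2πi` if `d` has one element, and to `0` if it has several. -/
theorem contourIntegral_inv_prod_sub {C : List Arc} (hC : IsClosedContour C) (n : ℕ) :
    ∀ d : List ℂ, d.length = n + 1 → (∀ μ ∈ d, μ ∉ contourTrace C) →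
      (∀ μ ∈ d, contourIntegral C (fun z => (z - μ)⁻¹) = 2 * Real.pi * Complex.I) →
      contourIntegral C (fun z => (d.map fun μ => z - μ).prod⁻¹) =
        if n = 0 then 2 * Real.pi * Complex.I else 0 := by
  induction n with
  | zero =>
    intro d hd _ hw
    obtain ⟨μ, rfl⟩ := List.length_eq_one_iff.1 hd
    simpa using hw μ (by simp)
  | succ n ih =>
    intro d hd htr hw
    obtain ⟨a, l, rfl⟩ := List.exists_cons_of_length_eq_add_one hd
    -- If all points coincide, the integrand is a power of order at most `-2` and has a primitive.
    -- Otherwise two distinct points `a`, `c` split it into two products with one factor fewer;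
    -- their integrals are equal and enter with opposite signs.
    by_cases hall : ∀ μ ∈ l, μ = a
    · have hl : l = List.replicate (n + 1) a :=
        List.eq_replicate_iff.2 ⟨by simpa using hd, hall⟩
      rw [if_neg n.succ_ne_zero]
      refine hC.contourIntegral_eq_zero (F := fun z => -((n + 1 : ℕ) : ℂ)⁻¹ * ((z - a) ^ (n + 1))⁻¹)
        (continuousOn_inv_prod_sub htr) fun z hz => ?_
      have hza : z - a ≠ 0 := sub_ne_zero.2 fun h => htr a (by simp) (h ▸ hz)
      have hn : ((n + 1 : ℕ) : ℂ) ≠ 0 := Nat.cast_ne_zero.2 n.succ_ne_zero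
      have h := ((((hasDerivAt_id z).sub_const a).pow (n + 1)).inv
        (pow_ne_zero _ hza)).const_mul (-((n + 1 : ℕ) : ℂ)⁻¹)
      refine h.congr_deriv ?_
      rw [hl]
      simp only [List.map_cons, List.map_replicate, List.prod_cons, List.prod_replicate,
        id, Nat.add_sub_cancel, mul_one, Pi.pow_apply]
      field_simp
      ring
    · push Not at hall
      obtain ⟨c, hcl, hca⟩ := hall
      obtain ⟨l', hl'⟩ : ∃ l', l.Perm (c :: l') := ⟨_, List.perm_cons_erase hcl⟩
      have hlen : l'.length = n := by
        have := hl'.length_eq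
        simp only [List.length_cons] at this hd
        omega
      have hsub : ∀ μ ∈ l', μ ∈ a :: l := fun μ hμ =>
        List.mem_cons_of_mem _ (hl'.mem_iff.2 (List.mem_cons_of_mem _ hμ))
      have hmem : ∀ e ∈ a :: l, ∀ μ ∈ e :: l', μ ∈ a :: l := fun e he μ hμ => by
        rcases List.mem_cons.1 hμ with rfl | h
        exacts [he, hsub μ h]
      have hI : ∀ e ∈ a :: l,
          contourIntegral C (fun z => ((e :: l').map fun μ => z - μ).prod⁻¹) =
            if n = 0 then 2 * Real.pi * Complex.I else 0 := fun e he =>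
        ih _ (by simp [hlen]) (fun μ hμ => htr μ (hmem e he μ hμ))
          fun μ hμ => hw μ (hmem e he μ hμ)
      have hac : a - c ≠ 0 := sub_ne_zero.2 (Ne.symm hca)
      have hcmem : c ∈ a :: l := List.mem_cons_of_mem _ hcl
      have hcont : ∀ e ∈ a :: l, ContinuousOn
          (fun z => ((e :: l').map fun μ => z - μ).prod⁻¹) (contourTrace C) := fun e he =>
        continuousOn_inv_prod_sub fun μ hμ => htr μ (hmem e he μ hμ)
      have hsplit : EqOn (fun z => ((a :: l).map fun μ => z - μ).prod⁻¹)
          (fun z => (a - c)⁻¹ * ((a :: l').map fun μ => z - μ).prod⁻¹ +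
            -(a - c)⁻¹ * ((c :: l').map fun μ => z - μ).prod⁻¹) (contourTrace C) := by
        intro z hz
        have hza : z - a ≠ 0 := sub_ne_zero.2 fun h => htr a (by simp) (h ▸ hz)
        have hzc : z - c ≠ 0 := sub_ne_zero.2 fun h => htr c hcmem (h ▸ hz)
        have hzp : (l'.map fun μ => z - μ).prod ≠ 0 :=
          prod_sub_ne_zero fun h => htr z (hsub z h) hz
        simp only [List.map_cons, List.prod_cons, (hl'.map _).prod_eq]
        field_simp
        ring
      rw [contourIntegral_congr hsplit,
        contourIntegral_add (continuousOn_const.fun_mul (hcont a (by simp)))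
          (continuousOn_const.fun_mul (hcont c hcmem)),
        contourIntegral_const_mul, contourIntegral_const_mul, hI a (by simp), hI c hcmem, if_neg n.succ_ne_zero]
      ring

/-! ### Riesz projection and Dunford formula in a Banach algebra. -/

section Algebra

open Polynomial

variable {𝔸 : Type*} [NormedRing 𝔸] [NormedAlgebra ℂ 𝔸] [CompleteSpace 𝔸]

theorem continuousOn_resolvent_mul {b : 𝔸} {s : Set ℂ} (hs : s ⊆ resolventSet ℂ b)
    (φ : 𝔸 →L[ℂ] ℂ) (N : 𝔸) : ContinuousOn (fun z => φ (resolvent b z * N)) s := by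
  have h : ContinuousOn (resolvent b : ℂ → 𝔸) s := fun z hz =>
    (spectrum.hasDerivAt_resolvent_const_left (hs hz)).continuousAt.continuousWithinAt
  exact φ.continuous.comp_continuousOn (h.mul continuousOn_const)

theorem resolvent_mul_sub {𝔸 : Type*} [Ring 𝔸] [Algebra ℂ 𝔸] {b : 𝔸} {z : ℂ} (hz : z ∈ resolventSet ℂ b) :
    resolvent b z * (algebraMap ℂ 𝔸 z - b) = 1 :=
  Ring.inverse_mul_cancel _ hz

/-- The identity `(z - a) R(z) q(b) = q(b) + R(z) (b - a) q(b)` moves a root `a` from `l` to `d` and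
multiplies `q` by `X - a`. The scalar term it leaves integrates to zero unless `d` was empty. Once
`l` is exhausted, `q(b) = 0` and nothing remains. -/
theorem contourIntegral_resolvent_aux {C : List Arc} (hC : IsClosedContour C) {b : 𝔸}
    (hb : contourTrace C ⊆ resolventSet ℂ b) (φ : 𝔸 →L[ℂ] ℂ) (l : List ℂ) :
    ∀ (d : List ℂ) (q : ℂ[X]), aeval b (q * (l.map fun μ => X - Polynomial.C μ).prod) = 0 →
      (∀ μ ∈ d ++ l, μ ∉ contourTrace C) →
      (∀ μ ∈ d ++ l, contourIntegral C (fun z => (z - μ)⁻¹) = 2 * Real.pi * Complex.I) →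
      contourIntegral C
        (fun z => (d.map fun μ => z - μ).prod⁻¹ * φ (resolvent b z * aeval b q)) =
          if d = [] then 2 * Real.pi * Complex.I * φ (aeval b q) else 0 := by
  induction l with
  | nil =>
    intro d q hq _ _
    have h0 : aeval b q = 0 := by simpa using hq
    have := contourIntegral_const_mul C 0 fun _ => 0
    simp only [h0, mul_zero, map_zero, ite_self, zero_mul] at this ⊢
    exact this
  | cons a l ih =>
    intro d q hq htr hw
    have hperm : ∀ μ, μ ∈ (a :: d) ++ l ↔ μ ∈ d ++ a :: l := fun μ => by
      simp only [List.mem_append, List.mem_cons]; tauto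
    have had : ∀ μ ∈ a :: d, μ ∈ d ++ a :: l := fun μ hμ =>
      (hperm μ).1 (List.mem_append_left _ hμ)
    have h1 := ih (a :: d) ((X - Polynomial.C a) * q)
      (by rw [← hq, List.map_cons, List.prod_cons]; congr 1; ring)
      (fun μ hμ => htr μ ((hperm μ).1 hμ)) (fun μ hμ => hw μ ((hperm μ).1 hμ))
    have h2 := contourIntegral_inv_prod_sub hC d.length (a :: d) (by simp)
      (fun μ hμ => htr μ (had μ hμ)) (fun μ hμ => hw μ (had μ hμ))
    have hcont := continuousOn_inv_prod_sub fun μ hμ => htr μ (had μ hμ)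
    have hsplit : EqOn
        (fun z => (d.map fun μ => z - μ).prod⁻¹ * φ (resolvent b z * aeval b q))
        (fun z => φ (aeval b q) * ((a :: d).map fun μ => z - μ).prod⁻¹ +
          ((a :: d).map fun μ => z - μ).prod⁻¹ *
            φ (resolvent b z * aeval b ((X - Polynomial.C a) * q))) (contourTrace C) := by
      intro z hz
      have hza : z - a ≠ 0 := sub_ne_zero.2 fun h => htr a (had a (by simp)) (h ▸ hz)
      have hR : (z - a) • (resolvent b z * aeval b q) =
          aeval b q + resolvent b z * aeval b ((X - Polynomial.C a) * q) := by
        have h3 := congrArg (· * aeval b q) (resolvent_mul_sub (hb hz))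
        simp only [one_mul] at h3
        nth_rewrite 2 [← h3]
        rw [map_mul, ← mul_assoc, ← add_mul, ← mul_add, map_sub, aeval_X, aeval_C,
          sub_add_sub_cancel, ← map_sub, ← Algebra.commutes, mul_assoc, ← Algebra.smul_def]
      have h4 := congrArg φ hR
      rw [map_smul, map_add, smul_eq_mul] at h4
      have h5 : φ (resolvent b z * aeval b q) = (z - a)⁻¹ * (φ (aeval b q) +
          φ (resolvent b z * aeval b ((X - Polynomial.C a) * q))) := by
        rw [← h4, inv_mul_cancel_left₀ hza]
      simp only [h5, List.map_cons, List.prod_cons, mul_inv]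
      ring
    rw [contourIntegral_congr hsplit, contourIntegral_add (continuousOn_const.fun_mul hcont)
      (hcont.fun_mul (continuousOn_resolvent_mul hb φ _)), contourIntegral_const_mul, h1, h2]
    simp only [List.length_eq_zero_iff, reduceCtorEq, if_false, add_zero]
    split_ifs <;> ring

/-- The Riesz projection belonging to the whole spectrum is the identity. -/
theorem contourIntegral_resolvent {C : List Arc} (hC : IsClosedContour C) {b : 𝔸}
    (hb : contourTrace C ⊆ resolventSet ℂ b) {l : List ℂ}
    (hl : aeval b (l.map fun μ => X - Polynomial.C μ).prod = 0)
    (htr : ∀ μ ∈ l, μ ∉ contourTrace C)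
    (hw : ∀ μ ∈ l, contourIntegral C (fun z => (z - μ)⁻¹) = 2 * Real.pi * Complex.I)
    (φ : 𝔸 →L[ℂ] ℂ) :
    contourIntegral C (fun z => φ (resolvent b z)) = 2 * Real.pi * Complex.I * φ 1 := by
  simpa using contourIntegral_resolvent_aux hC hb φ l [] 1 (by simpa using hl) (by simpa using htr)
    (by simpa using hw)

/-- Duhamel's formula, multiplied by the resolvent. -/
theorem exp_mul_resolvent_sub {b : 𝔸} {z : ℂ} (hz : z ∈ resolventSet ℂ b) (φ : 𝔸 →L[ℂ] ℂ)
    (t : ℝ) :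
    Complex.exp (t * z) * φ (resolvent b z) -
      φ (resolvent b z * NormedSpace.exp ((t : ℂ) • b)) =
    ∫ s in (0 : ℝ)..t, Complex.exp ((t - s) * z) * φ (NormedSpace.exp ((s : ℂ) • b)) := by
  have hexp : ∀ s : ℂ, HasDerivAt (fun s : ℂ => NormedSpace.exp (s • b))
      (b * NormedSpace.exp (s • b)) s := fun s => hasDerivAt_exp_smul_const' b s
  have hcexp : Continuous fun s : ℂ => NormedSpace.exp (s • b) :=
    continuous_iff_continuousAt.2 fun s => (hexp s).continuousAt
  have hd : ∀ s : ℝ, HasDerivAt (fun s : ℝ => -(Complex.exp ((t - s) * z) *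
      φ (resolvent b z * NormedSpace.exp ((s : ℂ) • b))))
      (Complex.exp ((t - s) * z) * φ (NormedSpace.exp ((s : ℂ) • b))) s := by
    intro s
    have h1 : HasDerivAt (fun s : ℂ => Complex.exp ((t - s) * z))
        (Complex.exp ((t - s) * z) * (-1 * z)) (s : ℂ) :=
      (((hasDerivAt_id (s : ℂ)).const_sub (t : ℂ)).mul_const z).cexp
    have h2 := φ.hasFDerivAt.comp_hasDerivAt (s : ℂ)
      ((hexp (s : ℂ)).const_mul (resolvent b z))
    have h3 := (h1.mul h2).neg.comp_ofReal
    refine h3.congr_deriv ?_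
    -- This is `R(z) (z - b) = 1` applied to `e^{sb}`; it makes the resolvent disappear from the
    -- derivative.
    have h4 : φ (NormedSpace.exp ((s : ℂ) • b)) =
        z * φ (resolvent b z * NormedSpace.exp ((s : ℂ) • b)) -
        φ (resolvent b z * (b * NormedSpace.exp ((s : ℂ) • b))) := by
      conv_lhs => rw [← one_mul (NormedSpace.exp ((s : ℂ) • b)), ← resolvent_mul_sub hz]
      rw [mul_assoc, sub_mul, mul_sub, map_sub, ← Algebra.smul_def, mul_smul_comm, map_smul,
        smul_eq_mul]
    rw [h4]
    simp only [Function.comp]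
    ring
  have hcont : Continuous fun s : ℝ =>
      Complex.exp ((t - s) * z) * φ (NormedSpace.exp ((s : ℂ) • b)) :=
    (by fun_prop : Continuous fun s : ℝ => Complex.exp ((t - s) * z)).mul
      (φ.continuous.comp (hcexp.comp Complex.continuous_ofReal))
  rw [intervalIntegral.integral_eq_sub_of_hasDerivAt (fun s _ => hd s)
    (hcont.intervalIntegrable _ _)]
  simp
  ring

/-- The Dunford formula for the exponential of an algebraic element of a Banach algebra. -/
theorem contourIntegral_exp_mul_resolvent {C : List Arc} (hC : IsClosedContour C) {b : 𝔸}
    (hb : contourTrace C ⊆ resolventSet ℂ b) {l : List ℂ}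
    (hl : aeval b (l.map fun μ => X - Polynomial.C μ).prod = 0)
    (htr : ∀ μ ∈ l, μ ∉ contourTrace C)
    (hw : ∀ μ ∈ l, contourIntegral C (fun z => (z - μ)⁻¹) = 2 * Real.pi * Complex.I)
    (φ : 𝔸 →L[ℂ] ℂ) (t : ℝ) :
    contourIntegral C (fun z => Complex.exp (t * z) * φ (resolvent b z)) =
      2 * Real.pi * Complex.I * φ (NormedSpace.exp ((t : ℂ) • b)) := by
  have hcexp : Continuous fun s : ℂ => NormedSpace.exp (s • b) :=
    continuous_iff_continuousAt.2 fun s => (hasDerivAt_exp_smul_const' b s).continuousAt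
  have hg : Continuous (Function.uncurry fun (z : ℂ) (s : ℝ) =>
      Complex.exp ((t - s) * z) * φ (NormedSpace.exp ((s : ℂ) • b))) := by
    refine Continuous.mul (by fun_prop) ?_
    exact φ.continuous.comp (hcexp.comp (Complex.continuous_ofReal.comp continuous_snd))
  -- The Duhamel integrand is entire in `z` with an explicit primitive, linear when `s = t`. After
  -- the interchange of integrals only `R(z) e^{tb}` contributes.
  have hzero : ∀ s : ℝ, contourIntegral C
      (fun z => Complex.exp ((t - s) * z) * φ (NormedSpace.exp ((s : ℂ) • b))) = 0 := by
    intro s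
    have hcont : ContinuousOn (fun z =>
        Complex.exp ((t - s) * z) * φ (NormedSpace.exp ((s : ℂ) • b))) (contourTrace C) := by
      fun_prop
    rcases eq_or_ne ((t : ℂ) - s) 0 with h0 | h0
    · refine hC.contourIntegral_eq_zero
        (F := fun z => z * φ (NormedSpace.exp ((s : ℂ) • b))) hcont fun z _ => ?_
      simpa [h0] using (hasDerivAt_id z).mul_const (φ (NormedSpace.exp ((s : ℂ) • b)))
    · refine hC.contourIntegral_eq_zero (F := fun z => ((t : ℂ) - s)⁻¹ *
        Complex.exp ((t - s) * z) * φ (NormedSpace.exp ((s : ℂ) • b))) hcont fun z _ => ?_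
      refine ((((hasDerivAt_id z).const_mul ((t : ℂ) - s)).cexp.const_mul
        ((t : ℂ) - s)⁻¹).mul_const _).congr_deriv ?_
      simp only [id]
      field_simp
  have hsplit : EqOn (fun z => Complex.exp (t * z) * φ (resolvent b z))
      (fun z => φ (resolvent b z * NormedSpace.exp ((t : ℂ) • b)) +
        ∫ s in (0 : ℝ)..t, Complex.exp ((t - s) * z) * φ (NormedSpace.exp ((s : ℂ) • b)))
      (contourTrace C) := fun z hz => by
    simp only [← exp_mul_resolvent_sub (hb hz)]
    ring
  -- The Riesz projection is tested against the functional `x ↦ φ (x e^{tb})`.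
  have hR := contourIntegral_resolvent hC hb hl htr hw
    (φ ∘L (ContinuousLinearMap.mul ℂ 𝔸).flip (NormedSpace.exp ((t : ℂ) • b)))
  rw [contourIntegral_congr hsplit, contourIntegral_add (continuousOn_resolvent_mul hb φ _)
    (intervalIntegral.continuous_parametric_intervalIntegral_of_continuous' hg _ _).continuousOn,
    contourIntegral_intervalIntegral_swap C hg]
  simp only [hzero, intervalIntegral.integral_zero, add_zero]
  simpa using hR

end Algebra


/-! ### Pseudospectra and resolvent bounds for matrices. -/

variable {n : ℕ}

local notation "toCLM" => Matrix.toEuclideanCLM (𝕜 := ℂ)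

theorem isEigenvalue_iff {M : Matrix (Fin n) (Fin n) ℂ} {z : ℂ} :
    IsEigenvalue M z ↔ ∃ v : EuclideanSpace ℂ (Fin n), v ≠ 0 ∧ toCLM M v = z • v := by
  unfold IsEigenvalue
  constructor
  · intro h
    obtain ⟨v, hv⟩ := h.exists_hasEigenvector
    refine ⟨WithLp.toLp 2 v, fun h0 => hv.2 ?_, ?_⟩
    · simpa using h0
    · rw [Matrix.toEuclideanCLM_toLp, ← WithLp.toLp_smul]
      congr 1
      simpa using hv.apply_eq_smul
  · rintro ⟨v, hv, h⟩
    refine Module.End.hasEigenvalue_of_hasEigenvector (x := v.ofLp)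
      (Module.End.hasEigenvector_iff.2 ⟨Module.End.mem_eigenspace_iff.2 ?_, fun h0 => hv ?_⟩)
    · rw [Matrix.toLin'_apply, ← Matrix.ofLp_toEuclideanCLM, h, WithLp.ofLp_smul]
    · simpa using h0

/-- Cauchy–Schwarz in each row. -/
theorem norm_toEuclideanCLM_apply_le (M : Matrix (Fin n) (Fin n) ℂ)
    (v : EuclideanSpace ℂ (Fin n)) : ‖toCLM M v‖ ≤ frobNorm M * ‖v‖ := by
  rw [EuclideanSpace.norm_eq, EuclideanSpace.norm_eq, frobNorm,
    ← Real.sqrt_mul (by positivity), Finset.sum_mul]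
  refine Real.sqrt_le_sqrt (Finset.sum_le_sum fun i _ => ?_)
  rw [Matrix.ofLp_toEuclideanCLM]
  have h : ‖M.mulVec v.ofLp i‖ ≤ ∑ j, ‖M i j‖ * ‖v.ofLp j‖ := by
    simpa [Matrix.mulVec, dotProduct] using norm_sum_le Finset.univ fun j => M i j * v.ofLp j
  exact (pow_le_pow_left₀ (norm_nonneg _) h 2).trans (Finset.sum_mul_sq_le_sq_mul_sq _ _ _)

theorem frobNorm_vecMulVec (w v : EuclideanSpace ℂ (Fin n)) :
    frobNorm (Matrix.vecMulVec w.ofLp v.ofLp) = ‖w‖ * ‖v‖ := by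
  rw [EuclideanSpace.norm_eq, EuclideanSpace.norm_eq, frobNorm,
    ← Real.sqrt_mul (by positivity), Finset.sum_mul_sum]
  simp [Matrix.vecMulVec_apply, mul_pow]

/-- The smallest singular value of `z - M` is at least `r` when `z` is not in the `r`-pseudospectrum. -/
theorem mul_norm_le_of_notMem_pseudospectrum {M : Matrix (Fin n) (Fin n) ℂ} {r : ℝ} {z : ℂ}
    (hz : z ∉ pseudospectrum r M) (v : EuclideanSpace ℂ (Fin n)) :
    r * ‖v‖ ≤ ‖z • v - toCLM M v‖ := by
  by_contra! hlt
  rcases eq_or_ne v 0 with rfl | hv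
  · simp at hlt
  have hv' : 0 < ‖v‖ := norm_pos_iff.2 hv
  set w := z • v - toCLM M v with hw
  -- With `u = conj v / ‖v‖²` the rank-one matrix `w uᵀ` sends `v` to `w` and has Frobenius norm
  -- `‖w‖ / ‖v‖ < r`. Adding it to `M` makes `v` an eigenvector for `z`.
  set u : EuclideanSpace ℂ (Fin n) := ((‖v‖ : ℂ) ^ 2)⁻¹ • WithLp.toLp 2 (star v.ofLp) with hu
  have hun : ‖u‖ = ‖v‖⁻¹ := by
    have h1 : ‖(WithLp.toLp 2 (star v.ofLp) : EuclideanSpace ℂ (Fin n))‖ = ‖v‖ := by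
      simp [EuclideanSpace.norm_eq]
    rw [hu, norm_smul, h1]
    simp
    field_simp
  refine hz ⟨Matrix.vecMulVec w.ofLp u.ofLp, ?_, isEigenvalue_iff.2 ⟨v, hv, ?_⟩⟩
  · rw [frobNorm_vecMulVec, hun, ← div_eq_mul_inv, div_le_iff₀ hv']
    exact hlt.le
  · have h2 : toCLM (Matrix.vecMulVec w.ofLp u.ofLp) v = w := by
      have h3 : u.ofLp ⬝ᵥ v.ofLp = 1 := by
        have h4 : star v.ofLp ⬝ᵥ v.ofLp = ((‖v‖ : ℂ) ^ 2) := by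
          rw [← Complex.ofReal_pow, EuclideanSpace.norm_sq_eq]
          simp [dotProduct, Complex.conj_mul']
        rw [hu]
        simp only [WithLp.ofLp_smul, smul_dotProduct, h4, smul_eq_mul]
        exact inv_mul_cancel₀ (pow_ne_zero 2 (Complex.ofReal_ne_zero.2 hv'.ne'))
      apply WithLp.ofLp_injective
      rw [Matrix.ofLp_toEuclideanCLM]
      ext i
      simp [Matrix.vecMulVec_mulVec, h3]
    rw [map_add, add_apply, h2, hw]
    abel

/-- The lower bound is a closed condition on `z`, hence survives where a contour touches the
boundary of the pseudospectrum. -/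
theorem mul_norm_le_of_mem_closure {M : Matrix (Fin n) (Fin n) ℂ} {r : ℝ} {z : ℂ}
    (hz : z ∈ closure (pseudospectrum r M)ᶜ) (v : EuclideanSpace ℂ (Fin n)) :
    r * ‖v‖ ≤ ‖z • v - toCLM M v‖ := by
  have hclosed : IsClosed {z : ℂ | r * ‖v‖ ≤ ‖z • v - toCLM M v‖} :=
    isClosed_le continuous_const (by fun_prop)
  exact closure_minimal (fun w hw => mul_norm_le_of_notMem_pseudospectrum hw v) hclosed hz

theorem mem_resolventSet_of_mul_norm_le {E : Type*} [NormedAddCommGroup E] [NormedSpace ℂ E]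
    [FiniteDimensional ℂ E] {b : E →L[ℂ] E} {ε : ℝ} (hε : 0 < ε) {z : ℂ}
    (h : ∀ v, ε * ‖v‖ ≤ ‖z • v - b v‖) : z ∈ resolventSet ℂ b := by
  have hinj : Function.Injective (algebraMap ℂ (E →L[ℂ] E) z - b) := by
    rw [injective_iff_map_eq_zero]
    intro v hv
    have h1 : z • v - b v = 0 := by simpa [Algebra.algebraMap_eq_smul_one] using hv
    have h2 := h v
    rw [h1, norm_zero] at h2
    exact norm_le_zero_iff.1 (nonpos_of_mul_nonpos_right h2 hε)
  exact ContinuousLinearMap.isUnit_iff_bijective.2 ⟨hinj,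
    LinearMap.injective_iff_surjective (f := (algebraMap ℂ (E →L[ℂ] E) z - b).toLinearMap).1 hinj⟩

theorem norm_resolvent_le {E : Type*} [NormedAddCommGroup E] [NormedSpace ℂ E]
    [FiniteDimensional ℂ E] {b : E →L[ℂ] E} {ε : ℝ} (hε : 0 < ε) {z : ℂ}
    (h : ∀ v, ε * ‖v‖ ≤ ‖z • v - b v‖) : ‖resolvent b z‖ ≤ ε⁻¹ := by
  refine ContinuousLinearMap.opNorm_le_bound _ (inv_nonneg.2 hε.le) fun v => ?_
  have h1 : (algebraMap ℂ (E →L[ℂ] E) z - b) * resolvent b z = 1 :=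
    Ring.mul_inverse_cancel _ (mem_resolventSet_of_mul_norm_le hε h)
  have h2 : z • resolvent b z v - b (resolvent b z v) = v := by
    simpa [Algebra.algebraMap_eq_smul_one] using congrArg (fun f : E →L[ℂ] E => f v) h1
  have h3 := h (resolvent b z v)
  rw [h2] at h3
  rwa [inv_mul_eq_div, le_div_iff₀' hε]

theorem toEuclideanCLM_exp (t : ℝ) (M : Matrix (Fin n) (Fin n) ℂ) :
    toCLM (NormedSpace.exp (t • M)) = NormedSpace.exp ((t : ℂ) • toCLM M) := by
  -- The exponential depends only on the topology; this auxiliary norm merely supplies a normed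
  -- algebra structure.
  let _ : NormedRing (Matrix (Fin n) (Fin n) ℂ) := Matrix.linftyOpNormedRing
  let _ : NormedAlgebra ℂ (Matrix (Fin n) (Fin n) ℂ) := Matrix.linftyOpNormedAlgebra
  let _ : NormedAlgebra ℚ (Matrix (Fin n) (Fin n) ℂ) := NormedAlgebra.restrictScalars ℚ ℂ _
  have hc : Continuous (toCLM : Matrix (Fin n) (Fin n) ℂ ≃⋆ₐ[ℂ] _) :=
    LinearMap.continuous_of_finiteDimensional
      ((toCLM : Matrix (Fin n) (Fin n) ℂ ≃⋆ₐ[ℂ] _).toAlgEquiv.toLinearMap)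
  rw [← map_smul, Complex.coe_smul]
  exact NormedSpace.map_exp (toCLM : Matrix (Fin n) (Fin n) ℂ ≃⋆ₐ[ℂ] _) hc (t • M)

/-! ### From the contour `C` to its left closing. -/

/-- The winding number around a point in the open left half-plane does not change when the part of
a contour in the closed right half-plane is replaced. -/
theorem IsLeftClosing.contourIntegral_inv_sub_eq {C Γ : List Arc} (hΓ : IsLeftClosing C Γ)
    (hC : IsClosedContour C) {μ : ℂ} (hμ : μ.re < 0) :
    contourIntegral Γ (fun z => (z - μ)⁻¹) = contourIntegral C (fun z => (z - μ)⁻¹) := by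
  obtain ⟨L, R, J, hCp, -, hR, hΓp, hΓc⟩ := hΓ
  set J' := J.map fun p => Arc.imagInterval p.1 p.2 with hJ'
  have hJ : ∀ z ∈ contourTrace J', 0 ≤ z.re := by
    rintro z ⟨γ, hγ, hz⟩
    obtain ⟨p, -, rfl⟩ := List.mem_map.1 hγ
    exact (Arc.trace_imagInterval_re hz).ge
  -- For `Re z ≥ 0` the point `z - μ` stays in the slit plane, so `F` is a primitive along `R` and
  -- along the imaginary intervals.
  set F : ℂ → ℂ := fun z => Complex.log (z - μ)
  have key : ∀ D : List Arc, (∀ z ∈ contourTrace D, 0 ≤ z.re) →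
      contourIntegral D (fun z => (z - μ)⁻¹) =
        (D.map fun γ => F γ.target - F γ.source).sum := fun D hD => by
    have hpos : ∀ z ∈ contourTrace D, 0 < (z - μ).re := fun z hz => by
      rw [Complex.sub_re]; linarith [hD z hz]
    refine contourIntegral_eq_sum_sub ?_ fun z hz => ?_
    · refine ContinuousOn.inv₀ (by fun_prop) fun z hz h0 => ?_
      have := hpos z hz
      simp [h0] at this
    · simpa using ((hasDerivAt_id z).sub_const μ).clog (Or.inl (hpos z hz))
  -- The increments of `F` over `R` and over the intervals both equal minus those over `L`, even if
  -- `F` is no primitive along `L`.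
  have h1 := hC.sum_sub_eq_zero F
  have h2 := hΓc.sum_sub_eq_zero F
  rw [(hCp.map _).sum_eq, List.map_append, List.sum_append] at h1
  rw [(hΓp.map _).sum_eq, List.map_append, List.sum_append] at h2
  rw [contourIntegral_perm hCp, contourIntegral_perm hΓp, contourIntegral_append,
    contourIntegral_append, key R hR, key J' hJ]
  linear_combination h2 - h1

end TransientBound

end

/-! ### The transient bound. -/

open TransientBound
theorem proposition2p1 {n : ℕ} (S : Submodule ℝ (Matrix (Fin n) (Fin n) ℂ))
    (A : Matrix (Fin n) (Fin n) ℂ) (hA : ∀ z, IsEigenvalue A z → z.re < 0)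
    (εstar : ℝ) (hεstar : IsStabilityRadius A εstar)
    (ε : ℝ) (hε : 0 < ε) (hε' : ε < εstar)
    (δ : ℝ) (hδ : IsStructuredStabilityRadius S ε A δ)
    (C Γ : List Arc) (hC : Surrounds C (pseudospectrum (ε + δ) A)) (hΓ : IsLeftClosing C Γ)
    (Δ : Matrix (Fin n) (Fin n) ℂ) (hΔS : Δ ∈ S) (hΔ : frobNorm Δ ≤ δ)
    (t : ℝ) (ht : 0 < t) :
    norm2 (NormedSpace.exp (t • (A + Δ))) ≤ contourLength Γ / (2 * Real.pi * ε) := by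
  set b := Matrix.toEuclideanCLM (𝕜 := ℂ) (A + Δ) with hb
  have hadd : ∀ v, b v = Matrix.toEuclideanCLM (𝕜 := ℂ) A v +
      Matrix.toEuclideanCLM (𝕜 := ℂ) Δ v := fun v => by rw [hb, map_add]; rfl
  have hΔn : ∀ v, ‖Matrix.toEuclideanCLM (𝕜 := ℂ) Δ v‖ ≤ δ * ‖v‖ := fun v =>
    (norm_toEuclideanCLM_apply_le Δ v).trans (mul_le_mul_of_nonneg_right hΔ (norm_nonneg v))
  -- The defining property of `δ` excludes only the open half-plane; the imaginary axis is reached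
  -- by closure.
  have hright : ∀ z : ℂ, 0 ≤ z.re → ∀ v, ε * ‖v‖ ≤ ‖z • v - b v‖ := fun z hz => by
    refine mul_norm_le_of_mem_closure ?_
    have hz' : z ∈ closure {w : ℂ | 0 < w.re} := by
      rw [Complex.closure_setOfPred_lt_re]; exact hz
    exact closure_mono (fun w hw hmem => hw.not_ge (hδ.1.2 Δ hΔS hΔ w hmem)) hz'
  -- `(ε + δ)‖v‖ ≤ ‖z v - A v‖ ≤ ‖z v - b v‖ + δ‖v‖`.
  have hCz : ∀ z ∈ contourTrace C, ∀ v, ε * ‖v‖ ≤ ‖z • v - b v‖ := fun z hz v => by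
    have h1 := mul_norm_le_of_mem_closure (hC.2.1 hz) v
    have h2 := norm_add_le (z • v - b v) (Matrix.toEuclideanCLM (𝕜 := ℂ) Δ v)
    have h3 : z • v - b v + Matrix.toEuclideanCLM (𝕜 := ℂ) Δ v =
      z • v - Matrix.toEuclideanCLM (𝕜 := ℂ) A v := by rw [hadd]; abel
    rw [h3] at h2
    linarith [hΔn v]
  obtain ⟨L, R, J, hCp, hL, -, hΓp, hΓc⟩ := id hΓ
  have hΓtr : ∀ z ∈ contourTrace Γ, z.re ≤ 0 ∧ ∀ v, ε * ‖v‖ ≤ ‖z • v - b v‖ := fun z hz => by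
    rw [contourTrace_perm hΓp, contourTrace_append] at hz
    rcases hz with hz | ⟨γ, hγ, hz⟩
    · refine ⟨hL z hz, hCz z ?_⟩
      rw [contourTrace_perm hCp, contourTrace_append]
      exact Or.inl hz
    · obtain ⟨p, -, rfl⟩ := List.mem_map.1 hγ
      have h0 := Arc.trace_imagInterval_re hz
      exact ⟨h0.le, hright z h0.ge⟩
  have hres : contourTrace Γ ⊆ resolventSet ℂ b := fun z hz =>
    mem_resolventSet_of_mul_norm_le hε (hΓtr z hz).2
  set l := (A + Δ).charpoly.roots.toList with hl
  have heig : ∀ μ ∈ l, ∃ v, v ≠ 0 ∧ b v = μ • v := fun μ hμ => by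
    rw [hl, Multiset.mem_toList] at hμ
    refine isEigenvalue_iff.1 ?_
    rw [IsEigenvalue, Module.End.hasEigenvalue_iff_mem_spectrum, Matrix.spectrum_toLin',
      Matrix.mem_spectrum_iff_isRoot_charpoly]
    exact Polynomial.isRoot_of_mem_roots hμ
  have hnot : ∀ μ ∈ l, ¬ ∀ v, ε * ‖v‖ ≤ ‖μ • v - b v‖ := fun μ hμ h => by
    obtain ⟨v, hv, hbv⟩ := heig μ hμ
    have h1 := h v
    rw [hbv, sub_self, norm_zero] at h1
    exact (mul_pos hε (norm_pos_iff.2 hv)).not_ge h1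
  have hann : Polynomial.aeval b (l.map fun μ => Polynomial.X - Polynomial.C μ).prod = 0 := by
    have h1 : (l.map fun μ => Polynomial.X - Polynomial.C μ).prod = (A + Δ).charpoly := by
      conv_rhs => rw [(IsAlgClosed.splits (A + Δ).charpoly).eq_prod_roots_of_monic
        (Matrix.charpoly_monic _), ← Multiset.coe_toList (A + Δ).charpoly.roots]
      simp [hl]
    rw [h1, hb, Polynomial.aeval_algHom_apply, Matrix.aeval_self_charpoly, map_zero]
  -- An eigenvalue of `b` violates the lower bound, so it lies neither in the closed right
  -- half-plane nor on `C`. It belongs to the surrounded set, with `Δ` itself as the perturbation.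
  have hw : ∀ μ ∈ l, contourIntegral Γ (fun z => (z - μ)⁻¹) = 2 * Real.pi * Complex.I :=
    fun μ hμ => by
    have hre : μ.re < 0 := not_le.1 fun h => hnot μ hμ (hright μ h)
    have hmem : μ ∈ pseudospectrum (ε + δ) A :=
      ⟨Δ, hΔ.trans (by linarith), isEigenvalue_iff.2 (heig μ hμ)⟩
    have h1 := hC.2.2 μ hmem fun h => hnot μ hμ (hCz μ h)
    rw [hΓ.contourIntegral_inv_sub_eq hC.1 hre]
    exact ((inv_mul_eq_one₀ Complex.two_pi_I_ne_zero).1 h1).symm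
  have hpi : 0 < 2 * Real.pi := by positivity
  have hexp : ∀ z ∈ contourTrace Γ, ‖Complex.exp (t * z)‖ ≤ 1 := fun z hz => by
    rw [Complex.norm_exp]
    simpa using mul_nonpos_of_nonneg_of_nonpos ht.le (hΓtr z hz).1
  rw [norm2, toEuclideanCLM_exp]
  set M := NormedSpace.exp ((t : ℂ) • b) with hM
  -- A norming functional of norm at most one reduces the matrix integral to a scalar one; this form
  -- also covers `M = 0`, as for `n = 0`.
  obtain ⟨φ, hφ, hφM⟩ := exists_dual_vector'' ℂ M
  have hdun := contourIntegral_exp_mul_resolvent hΓc hres hann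
    (fun μ hμ h => hnot μ hμ (hΓtr μ h).2) hw φ t
  have hcont : ContinuousOn (fun z => Complex.exp (t * z) * φ (resolvent b z))
      (contourTrace Γ) := by
    refine ContinuousOn.mul (by fun_prop) ?_
    simpa using continuousOn_resolvent_mul hres φ 1
  have hbound := norm_contourIntegral_le (K := ε⁻¹) hcont fun z hz => by
    rw [norm_mul, ← one_mul ε⁻¹]
    refine mul_le_mul (hexp z hz) ?_ (norm_nonneg _) zero_le_one
    refine (φ.le_opNorm _).trans ?_
    rw [← one_mul ε⁻¹]
    exact mul_le_mul hφ (norm_resolvent_le hε (hΓtr z hz).2) (norm_nonneg _) zero_le_one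
  rw [hdun, hφM, norm_mul] at hbound
  have h2pi : ‖(2 * Real.pi * Complex.I : ℂ)‖ = 2 * Real.pi := by
    simp [abs_of_pos Real.pi_pos]
  rw [h2pi, RCLike.norm_ofReal, abs_norm, inv_mul_eq_div, le_div_iff₀ hε] at hbound
  rw [le_div_iff₀ (by positivity)]
  linarith
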